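/- A \emph{dimension function} is a non-decreasing continuous function $h:[0,\infty)\to[0,\infty)$ with $h(0)=0$; it is \emph{doubling} if there is a constant $C>0$ such that $h(2x)\le C\,h(x)$ for all $x\ge 0$. For a dimension function $h$ and a set $E\subseteq\mathbb{R}^2$ let $$\mathcal{H}^h(E)=\sup_{\delta>0}\ \inf\Big\{\sum_i h(\operatorname{diam}E_i)\ :\ E\subseteq\bigcup_{i=1}^\infty E_i,\ \operatorname{diam}E_i<\delta\Big\}.$$ For functions $g,f:[0,\infty)\to[0,\infty)$ write $g\prec f$ if $g(x)>0$ for all sufficiently small $x>0$ and $\lim_{x\to0^+} f(x)/g(x)=0$. Given a dimension function $\mathfrak{h}$, a set $E\subseteq\mathbb{R}^2$ (not assumed measurable) is an \emph{$F_{\mathfrak h}$-set} if for every unit vector $e\in\mathbb{R}^2$ there is a line segment $\ell_e$ in the direction of $e$ with $\mathcal{H}^{\mathfrak h}(\ell_e\cap E)>0$. \textbf{Theorem.} Let $\mathfrak{h}$ be a doubling dimension function and let $E$ be an $F_{\mathfrak h}$-set. Let $h$ be a dimension function such that $h\prec\mathfrak{h}^2$. If $$\sum_{k\ge0}\sqrt{k\,\frac{\mathfrak{h}(2^{-k})^2}{h(2^{-k})}}<\infty,$$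 then $\mathcal{H}^h(E)>0$. -/

import Mathlib

open Filter Topology MeasureTheory Set
open scoped NNReal ENNReal

/-- A dimension function: a non-decreasing continuous function from `[0, ∞)` to `[0, ∞)`
that vanishes at `0`. -/
structure IsDimensionFunction (h : ℝ≥0 → ℝ≥0) : Prop where
  monotone : Monotone h
  continuous : Continuous h
  map_zero : h 0 = 0

/-- A doubling dimension function. -/
structure IsDoublingDimensionFunction (h : ℝ≥0 → ℝ≥0) : Prop
    extends IsDimensionFunction h where
  doubling : ∃ C : ℝ≥0, 0 < C ∧ ∀ x : ℝ≥0, h (2 * x) ≤ C * h x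

/-- `g ≺ h`: the quotient `h / g` makes sense near `0` from the right and tends to `0` there.
The first conjunct rules out division by zero. -/
def DimensionallySmaller (g h : ℝ≥0 → ℝ≥0) : Prop :=
  (∀ᶠ x in 𝓝[>] (0 : ℝ≥0), 0 < g x) ∧
    Tendsto (fun x => h x / g x) (𝓝[>] (0 : ℝ≥0)) (𝓝 0)

open Classical in
/-- The generalized Hausdorff (outer) measure of `h`, defined on all subsets of `X`: the supremum
over `δ > 0` of the infimum of `∑ i, h (diam (t i))` over all countable covers by sets `t i` of
diameter at most `δ`. Sets of infinite diameter get the value `∞`, hence play no role. -/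
noncomputable def generalizedHausdorff (X : Type*) [EMetricSpace X] (h : ℝ≥0 → ℝ≥0) :
    OuterMeasure X :=
  OuterMeasure.mkMetric fun d : ℝ≥0∞ => if d = ∞ then ∞ else (h d.toNNReal : ℝ≥0∞)

/-- Furstenberg sets of type `h` in the Euclidean plane: in each direction `e` there is a
(non-degenerate) line segment whose intersection with `E` has positive `h`-measure. -/
def IsFurstenbergSet (h : ℝ≥0 → ℝ≥0) (E : Set (EuclideanSpace ℝ (Fin 2))) : Prop :=
  ∀ e : EuclideanSpace ℝ (Fin 2), ‖e‖ = 1 →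
    ∃ (a : EuclideanSpace ℝ (Fin 2)) (t : ℝ), 0 < t ∧
      0 < generalizedHausdorff (EuclideanSpace ℝ (Fin 2)) h (segment ℝ a (a + t • e) ∩ E)

/-!
Sort the sets of a cover of `E` by the dyadic size `2 ^ (-k)` of their diameters, and replace those
of the `k`-th range by boundedly many cells of a grid of mesh comparable to `2 ^ (-k)`. Along a line
on which `E` has `𝔥`-content at least `η`, the cells met at scale `k`, weighted by `𝔥 (2 ^ (-k))`,
add up to at least `η`. If `a k` is the `k`-th term of the convergent series, then some scale
contributes more than a fixed multiple of `a k`, so the line meets more than a multiple of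
`√(k / h (2 ^ (-k)))` of the cells chosen at that scale. Conversely, two lines whose slopes are at
least `d` mesh sizes apart share at most a multiple of `2 ^ k / d` cells over an interval of
length `1`. Counting incidences with the Cauchy–Schwarz inequality, where `∑ 1 / d` costs a
factor `k`, shows that the slopes of the lines that meet more than `N` of `P` cells have measure at
most a multiple of `k P / N ^ 2`; for the above `N` this is a multiple of `P h (2 ^ (-k))`. Summing
over `k`, the total `h`-weight of the cover dominates the measure of the set of slopes.
-/

local notation "ℝ²" => EuclideanSpace ℝ (Fin 2)

section Counting

variable {ι α : Type*} [DecidableEq α] {T : Finset ι} {P : Finset α} {R : ι → Finset α}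

theorem sq_sum_card_le_card_mul_sum_card_inter (hRP : ∀ i ∈ T, R i ⊆ P) :
    (∑ i ∈ T, (R i).card) ^ 2 ≤ P.card * ∑ i ∈ T, ∑ j ∈ T, (R i ∩ R j).card := by
  have hcount : ∀ Q ⊆ P, Q.card = ∑ z ∈ P, if z ∈ Q then 1 else 0 := fun Q hQ => by
    rw [Finset.sum_boole, Finset.filter_mem_eq_inter, Finset.inter_eq_right.2 hQ, Nat.cast_id]
  have hfirst : ∑ i ∈ T, (R i).card = ∑ z ∈ P, ∑ i ∈ T, if z ∈ R i then 1 else 0 := by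
    rw [Finset.sum_comm]
    exact Finset.sum_congr rfl fun i hi => hcount _ (hRP i hi)
  have hsecond : ∑ i ∈ T, ∑ j ∈ T, (R i ∩ R j).card =
      ∑ z ∈ P, (∑ i ∈ T, if z ∈ R i then 1 else 0) ^ 2 := by
    simp_rw [sq, Finset.sum_mul_sum, ite_zero_mul_ite_zero, ← Finset.mem_inter, mul_one]
    rw [Finset.sum_comm (s := P)]
    refine Finset.sum_congr rfl fun i hi => ?_
    rw [Finset.sum_comm (s := P)]
    exact Finset.sum_congr rfl fun j _ => hcount _ (Finset.inter_subset_left.trans (hRP i hi))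
  rw [hfirst, hsecond]
  exact_mod_cast sq_sum_le_card_mul_sum_sq

theorem card_mul_sq_le_of_sum_card_inter_le (hRP : ∀ i ∈ T, R i ⊆ P) {N B : ℝ} (hN0 : 0 ≤ N)
    (hN : ∀ i ∈ T, N ≤ (R i).card) (hB0 : 0 ≤ B)
    (hB : ∀ i ∈ T, ∑ j ∈ T, ((R i ∩ R j).card : ℝ) ≤ B) :
    T.card * N ^ 2 ≤ B * P.card := by
  rcases T.eq_empty_or_nonempty with rfl | hT
  · simpa using mul_nonneg hB0 P.card.cast_nonneg
  have hTpos : (0 : ℝ) < T.card := by exact_mod_cast hT.card_pos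
  refine le_of_mul_le_mul_left ?_ hTpos
  calc (T.card : ℝ) * (T.card * N ^ 2) = (T.card * N) ^ 2 := by ring
    _ ≤ (∑ i ∈ T, ((R i).card : ℝ)) ^ 2 := by
        gcongr
        simpa using Finset.card_nsmul_le_sum T _ N hN
    _ ≤ P.card * ∑ i ∈ T, ∑ j ∈ T, ((R i ∩ R j).card : ℝ) := by
        exact_mod_cast sq_sum_card_le_card_mul_sum_card_inter hRP
    _ ≤ P.card * (T.card * B) := by
        gcongr
        simpa using Finset.sum_le_card_nsmul T _ B hB
    _ = T.card * (B * P.card) := by ring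

end Counting

theorem sum_natAbs_sub_le {f : ℕ → ℝ} (hf : ∀ d, 0 ≤ f d) {T : Finset ℤ} {i : ℤ} {L : ℕ}
    (hT : ∀ j ∈ T, (i - j).natAbs < L) :
    ∑ j ∈ T, f (i - j).natAbs ≤ 2 * ∑ d ∈ Finset.range L, f d := by
  rw [← Finset.sum_fiberwise_of_maps_to (fun j hj => Finset.mem_range.2 (hT j hj)),
    Finset.mul_sum]
  refine Finset.sum_le_sum fun d _ => ?_
  have hfiber : {j ∈ T | (i - j).natAbs = d} ⊆ {i - d, i + d} := fun j hj => by
    have := (Finset.mem_filter.1 hj).2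
    rw [Finset.mem_insert, Finset.mem_singleton]
    omega
  have hcard : ({j ∈ T | (i - j).natAbs = d}.card : ℝ) ≤ 2 := by
    exact_mod_cast (Finset.card_le_card hfiber).trans Finset.card_le_two
  calc ∑ j ∈ T with (i - j).natAbs = d, f (i - j).natAbs
      = {j ∈ T | (i - j).natAbs = d}.card * f d := by
        rw [Finset.sum_congr rfl fun j hj => by rw [(Finset.mem_filter.1 hj).2],
          Finset.sum_const, nsmul_eq_mul]
    _ ≤ 2 * f d := by gcongr; exact hf d

theorem sum_inv_natAbs_sub_add_one_le {T : Finset ℤ} {i : ℤ} {L : ℕ}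
    (hT : ∀ j ∈ T, (i - j).natAbs < L) :
    ∑ j ∈ T, ((i - j).natAbs + 1 : ℝ)⁻¹ ≤ 2 * (1 + Real.log L) := by
  have hharmonic : ((harmonic L : ℚ) : ℝ) = ∑ d ∈ Finset.range L, (d + 1 : ℝ)⁻¹ := by
    simp [harmonic]
  refine (sum_natAbs_sub_le (f := fun d => (d + 1 : ℝ)⁻¹) (fun d => by positivity) hT).trans ?_
  rw [← hharmonic]
  gcongr
  exact harmonic_le_one_add_log L

theorem floor_mem_Icc_of_abs_sub_le {x y : ℝ} {M : ℕ} (h : |x - y| ≤ M) :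
    ⌊x⌋ ∈ Finset.Icc (⌊y⌋ - M) (⌊y⌋ + M) := by
  obtain ⟨hlo, hhi⟩ := abs_le.1 h
  rw [Finset.mem_Icc, ← Int.floor_sub_natCast, ← Int.floor_add_natCast]
  exact ⟨Int.floor_le_floor (by linarith), Int.floor_le_floor (by linarith)⟩

section Grid

/-- The index of the cell of the half-open square grid of mesh `1 / n` that contains `p`. -/
noncomputable def gridCell (n : ℕ) (p : ℝ²) : ℤ × ℤ := (⌊n * p 0⌋, ⌊n * p 1⌋)

/-- The line with slope `s` and intercept `b`. -/
def slopeLine (s b : ℝ) : Set ℝ² := {p | p 1 = s * p 0 + b}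

/-- The vertical strip over a set `I` of first coordinates. -/
def verticalStrip (I : Set ℝ) : Set ℝ² := {p | p 0 ∈ I}

variable {n M : ℕ} {s s' b b' u v : ℝ}

theorem abs_mul_sub_lt_one_of_gridCell_eq {p q : ℝ²} (h : gridCell n p = gridCell n q) :
    |n * (p 0 - q 0)| < 1 ∧ |n * (p 1 - q 1)| < 1 := by
  rw [mul_sub, mul_sub]
  exact ⟨Int.abs_sub_lt_one_of_floor_eq_floor (congrArg Prod.fst h),
    Int.abs_sub_lt_one_of_floor_eq_floor (congrArg Prod.snd h)⟩

theorem card_gridCells_line_le (hs : |s| ≤ M) (huv : u ≤ v) {Q : Finset (ℤ × ℤ)}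
    (hQ : ↑Q ⊆ gridCell n '' (slopeLine s b ∩ verticalStrip (Icc u v))) :
    (Q.card : ℝ) ≤ (2 * M + 1) * (n * (v - u) + 2) := by
  set columns := Finset.Icc ⌊n * u⌋ ⌊n * v⌋ with hcolumns
  have hsub : Q ⊆ columns.biUnion fun c =>
      {c} ×ˢ Finset.Icc (⌊s * c + n * b⌋ - M) (⌊s * c + n * b⌋ + M) := by
    intro z hz
    obtain ⟨p, ⟨hp, hup, hpv⟩, rfl⟩ := hQ hz
    have hrow : |n * p 1 - (s * ⌊n * p 0⌋ + n * b)| ≤ M := by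
      have hfract : n * p 1 - (s * ⌊n * p 0⌋ + n * b) = s * Int.fract (n * p 0) := by
        rw [show p 1 = s * p 0 + b from hp, ← Int.self_sub_floor]
        ring
      rw [hfract, abs_mul, Int.abs_fract]
      exact (mul_le_of_le_one_right (abs_nonneg s) (Int.fract_lt_one _).le).trans hs
    refine Finset.mem_biUnion.2 ⟨⌊n * p 0⌋, Finset.mem_Icc.2 ⟨?_, ?_⟩,
      Finset.mk_mem_product (Finset.mem_singleton_self _) (floor_mem_Icc_of_abs_sub_le hrow)⟩
    all_goals exact Int.floor_le_floor (by gcongr)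
  have hcard : Q.card ≤ columns.card * (2 * M + 1) := by
    refine (Finset.card_le_card hsub).trans (Finset.card_biUnion_le_card_mul _ _ _ fun c _ => ?_)
    rw [Finset.card_product, Finset.card_singleton, Int.card_Icc]
    omega
  have hcard_columns : (columns.card : ℝ) ≤ n * (v - u) + 2 := by
    have hfloor : ⌊n * u⌋ ≤ ⌊n * v⌋ := Int.floor_le_floor (by gcongr)
    have hcast : ((columns.card : ℤ) : ℝ) = ⌊n * v⌋ + 1 - ⌊n * u⌋ := by
      rw [hcolumns, Int.card_Icc_of_le _ _ (by omega)]
      push_cast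
      ring
    rw [← Int.cast_natCast, hcast]
    linarith [Int.floor_le (n * v), Int.lt_floor_add_one (n * u)]
  calc (Q.card : ℝ) ≤ columns.card * (2 * M + 1) := by exact_mod_cast hcard
    _ ≤ (n * (v - u) + 2) * (2 * M + 1) := by gcongr
    _ = _ := mul_comm _ _

theorem gridCell_image_line_inter_subset (hn : 0 < n) (hs' : |s'| ≤ M) (hne : s ≠ s') :
    gridCell n '' slopeLine s b ∩ gridCell n '' slopeLine s' b' ⊆
      gridCell n '' (slopeLine s b ∩ verticalStrip
        (Metric.closedBall ((b' - b) / (s - s')) ((M + 1) / (n * |s - s'|)))) := by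
  rintro _ ⟨⟨p, hp, rfl⟩, ⟨q, hq, hqp⟩⟩
  refine ⟨p, ⟨hp, ?_⟩, rfl⟩
  obtain ⟨h0, h1⟩ := abs_mul_sub_lt_one_of_gridCell_eq hqp.symm
  have hsub : s - s' ≠ 0 := sub_ne_zero.2 hne
  have hpos : 0 < n * |s - s'| := mul_pos (Nat.cast_pos.2 hn) (abs_pos.2 hsub)
  have hidentity : n * (s - s') * (p 0 - (b' - b) / (s - s')) =
      n * (p 1 - q 1) - s' * (n * (p 0 - q 0)) := by
    rw [show p 1 = s * p 0 + b from hp, show q 1 = s' * q 0 + b' from hq]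
    field_simp
    ring
  change |p 0 - (b' - b) / (s - s')| ≤ _
  rw [le_div_iff₀ hpos]
  calc |p 0 - (b' - b) / (s - s')| * (n * |s - s'|)
      = |n * (p 1 - q 1) - s' * (n * (p 0 - q 0))| := by
        rw [← hidentity, abs_mul, abs_mul, Nat.abs_cast, mul_comm]
    _ ≤ |n * (p 1 - q 1)| + |s'| * |n * (p 0 - q 0)| := by
        rw [← abs_mul]
        exact abs_sub _ _
    _ ≤ 1 + M * 1 := by gcongr
    _ = M + 1 := by ring

theorem card_gridCells_two_lines_le (hn : 0 < n) (hs : |s| ≤ M) (hs' : |s'| ≤ M) (hne : s ≠ s')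
    {Q : Finset (ℤ × ℤ)} (hQ : ↑Q ⊆ gridCell n '' slopeLine s b)
    (hQ' : ↑Q ⊆ gridCell n '' slopeLine s' b') :
    (Q.card : ℝ) ≤ (2 * M + 1) * (2 * (M + 1) / |s - s'| + 2) := by
  have hne0 : |s - s'| ≠ 0 := abs_ne_zero.2 (sub_ne_zero.2 hne)
  have hradius : 0 ≤ (M + 1) / (n * |s - s'|) := by positivity
  have hsub := (subset_inter hQ hQ').trans (gridCell_image_line_inter_subset hn hs' hne)
  rw [Real.closedBall_eq_Icc] at hsub
  refine (card_gridCells_line_le hs (by linarith) hsub).trans_eq ?_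
  field_simp
  ring

/-- The constant in the bound for the number of common cells of two lines whose slopes are bounded
by `M`. -/
def overlapConst (M : ℕ) : ℝ := (2 * M + 1) * (6 * M + 8)

theorem overlapConst_pos (M : ℕ) : 0 < overlapConst M := by
  unfold overlapConst
  positivity

theorem natAbs_floor_sub_floor_sub_one_lt (n : ℕ) (s s' : ℝ) :
    ((⌊n * s⌋ - ⌊n * s'⌋).natAbs : ℝ) - 1 < n * |s - s'| := by
  have hdist : |(⌊n * s⌋ : ℝ) - ⌊n * s'⌋| < |n * (s - s')| + 1 := by
    have := le_abs_self (n * (s - s'))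
    have := neg_abs_le (n * (s - s'))
    rw [abs_lt]
    constructor <;> linarith [Int.floor_le (n * s), Int.lt_floor_add_one (n * s),
      Int.floor_le (n * s'), Int.lt_floor_add_one (n * s')]
  rw [abs_mul, Nat.abs_cast] at hdist
  rw [Nat.cast_natAbs]
  push_cast
  linarith

theorem card_gridCells_inter_le (hs : |s| ≤ M) (hs' : |s'| ≤ M)
    (hlt : (⌊n * s⌋ - ⌊n * s'⌋).natAbs < n) {Q : Finset (ℤ × ℤ)}
    (hQ : ↑Q ⊆ gridCell n '' (slopeLine s b ∩ verticalStrip (Icc u (u + 1))))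
    (hQ' : ↑Q ⊆ gridCell n '' slopeLine s' b') :
    (Q.card : ℝ) ≤ overlapConst M * n * ((⌊n * s⌋ - ⌊n * s'⌋).natAbs + 1 : ℝ)⁻¹ := by
  set d := (⌊n * s⌋ - ⌊n * s'⌋).natAbs
  have hn : 0 < n := by omega
  have hn1 : (1 : ℝ) ≤ n := by exact_mod_cast hn
  have hdn : (d + 1 : ℝ) ≤ n := by exact_mod_cast hlt
  rw [← div_eq_mul_inv, le_div_iff₀ (by positivity), overlapConst, mul_assoc]
  rcases le_or_gt d 1 with hclose | hfar
  · have hd1 : (d : ℝ) ≤ 1 := by exact_mod_cast hclose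
    have hline : (Q.card : ℝ) ≤ (2 * M + 1) * (n + 2) := by
      simpa using card_gridCells_line_le hs (le_add_of_nonneg_right zero_le_one) hQ
    calc (Q.card : ℝ) * (d + 1) ≤ (2 * M + 1) * (n + 2) * (1 + 1) := by gcongr
      _ = (2 * M + 1) * (2 * n + 4 * 1) := by ring
      _ ≤ (2 * M + 1) * (2 * n + 4 * n) := by gcongr
      _ ≤ (2 * M + 1) * ((6 * M + 8) * n) := by gcongr; nlinarith
  · have hd2 : (2 : ℝ) ≤ d := by exact_mod_cast hfar
    have hsep : (d + 1 : ℝ) ≤ 3 * (n * |s - s'|) := by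
      linarith [natAbs_floor_sub_floor_sub_one_lt n s s']
    have hpos : 0 < |s - s'| := by
      by_contra hnot
      nlinarith
    have hQs : ↑Q ⊆ gridCell n '' slopeLine s b := hQ.trans (image_mono inter_subset_left)
    calc (Q.card : ℝ) * (d + 1)
        ≤ ((2 * M + 1) * (2 * (M + 1) / |s - s'| + 2)) * (d + 1) := by
          gcongr
          exact card_gridCells_two_lines_le hn hs hs' (sub_ne_zero.1 (abs_pos.1 hpos)) hQs hQ'
      _ = (2 * M + 1) * (2 * (M + 1) / |s - s'| * (d + 1) + 2 * (d + 1)) := by ring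
      _ ≤ (2 * M + 1) * (2 * (M + 1) / |s - s'| * (3 * (n * |s - s'|)) + 2 * n) := by gcongr
      _ = (2 * M + 1) * ((6 * M + 8) * n) := by
          field_simp
          ring

end Grid

section SlopeCounting

variable {n M : ℕ} {m : ℤ} {S : Set ℝ} {b u : ℝ → ℝ} {N : ℝ}

theorem card_slopes_mul_sq_le (hn : 0 < n) {T : Finset ℝ} (hTM : ∀ s ∈ T, |s| ≤ M)
    (hinj : InjOn (fun s : ℝ => ⌊n * s⌋) T)
    (hlt : ∀ s ∈ T, ∀ t ∈ T, (⌊n * s⌋ - ⌊n * t⌋).natAbs < n)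
    {P : Finset (ℤ × ℤ)} {R : ℝ → Finset (ℤ × ℤ)} (hRP : ∀ s ∈ T, R s ⊆ P)
    (hR : ∀ s ∈ T, ↑(R s) ⊆
      gridCell n '' (slopeLine s (b s) ∩ verticalStrip (Icc (u s) (u s + 1))))
    (hN0 : 0 ≤ N) (hN : ∀ s ∈ T, N ≤ (R s).card) :
    T.card * N ^ 2 ≤ overlapConst M * n * (2 * (1 + Real.log n)) * P.card := by
  have hM := overlapConst_pos M
  refine card_mul_sq_le_of_sum_card_inter_le hRP hN0 hN (by positivity) fun s hs => ?_
  calc ∑ t ∈ T, ((R s ∩ R t).card : ℝ)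
      ≤ ∑ t ∈ T, overlapConst M * n * ((⌊n * s⌋ - ⌊n * t⌋).natAbs + 1 : ℝ)⁻¹ := by
        refine Finset.sum_le_sum fun t ht => ?_
        refine card_gridCells_inter_le (hTM s hs) (hTM t ht) (hlt s hs t ht)
          (Subset.trans ?_ (hR s hs))
          (Subset.trans ?_ ((hR t ht).trans (image_mono inter_subset_left)))
        · exact Finset.coe_subset.2 Finset.inter_subset_left
        · exact Finset.coe_subset.2 Finset.inter_subset_right
    _ = overlapConst M * n *
          ∑ j ∈ T.image fun t : ℝ => ⌊n * t⌋, ((⌊n * s⌋ - j).natAbs + 1 : ℝ)⁻¹ := by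
        rw [← Finset.mul_sum, Finset.sum_image hinj]
    _ ≤ overlapConst M * n * (2 * (1 + Real.log n)) := by
        gcongr
        exact sum_inv_natAbs_sub_add_one_le (Finset.forall_mem_image.2 fun t ht => hlt s hs t ht)

theorem floor_mul_mem_Ico (hn : 0 < n) {s : ℝ} (hs : s ∈ Ico (m : ℝ) (m + 1)) :
    ⌊n * s⌋ ∈ Ico (n * m : ℤ) (n * m + n) := by
  have hnpos : (0 : ℝ) < n := Nat.cast_pos.2 hn
  refine ⟨Int.le_floor.2 ?_, Int.floor_lt.2 ?_⟩
  · push_cast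
    gcongr
    exact hs.1
  · push_cast
    nlinarith [hs.2]

theorem natAbs_floor_sub_floor_lt (hn : 0 < n) {s t : ℝ} (hs : s ∈ Ico (m : ℝ) (m + 1))
    (ht : t ∈ Ico (m : ℝ) (m + 1)) : (⌊n * s⌋ - ⌊n * t⌋).natAbs < n := by
  have := floor_mul_mem_Ico hn hs
  have := floor_mul_mem_Ico hn ht
  simp only [mem_Ico] at *
  omega

theorem exists_separated_slopes (hn : 0 < n) (hS : S ⊆ Ico (m : ℝ) (m + 1)) :
    ∃ T : Finset ℝ, ↑T ⊆ S ∧ InjOn (fun s : ℝ => ⌊n * s⌋) T ∧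
      volume S ≤ ENNReal.ofReal (T.card / n) := by
  have hnpos : (0 : ℝ) < n := Nat.cast_pos.2 hn
  obtain ⟨T, hTS, hT⟩ := exists_subset_bijOn S fun s : ℝ => ⌊n * s⌋
  have hfin : T.Finite := by
    refine hT.finite_iff_finite.2 ((finite_Ico (n * m : ℤ) (n * m + n)).subset ?_)
    exact image_subset_iff.2 fun s hs => floor_mul_mem_Ico hn (hS hs)
  lift T to Finset ℝ using hfin
  refine ⟨T, hTS, hT.injOn, ?_⟩
  have hcover : S ⊆ ⋃ t ∈ T, Ico ((⌊n * t⌋ : ℝ) / n) ((⌊n * t⌋ + 1) / n) := by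
    intro s hs
    obtain ⟨t, ht, hts⟩ := hT.surjOn (mem_image_of_mem _ hs)
    have hts : ⌊n * t⌋ = ⌊n * s⌋ := hts
    rw [mem_iUnion₂]
    refine ⟨t, ht, ?_⟩
    rw [hts, mem_Ico, div_le_iff₀' hnpos, lt_div_iff₀' hnpos]
    exact ⟨Int.floor_le _, Int.lt_floor_add_one _⟩
  calc volume S ≤ ∑ t ∈ T, volume (Ico ((⌊n * t⌋ : ℝ) / n) ((⌊n * t⌋ + 1) / n)) :=
        (measure_mono hcover).trans (measure_biUnion_finset_le _ _)
    _ = ∑ _ ∈ T, ENNReal.ofReal (1 / n) := by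
        refine Finset.sum_congr rfl fun t _ => ?_
        rw [Real.volume_Ico, ← sub_div, add_sub_cancel_left]
    _ = ENNReal.ofReal (T.card / n) := by
        rw [Finset.sum_const, ← ENNReal.ofReal_nsmul, nsmul_eq_mul, mul_one_div]

theorem abs_le_natAbs_add_one {s : ℝ} (hs : s ∈ Ico (m : ℝ) (m + 1)) :
    |s| ≤ (m.natAbs + 1 : ℕ) := by
  rw [Nat.cast_add_one, Nat.cast_natAbs, Int.cast_abs, abs_le]
  constructor <;> linarith [hs.1, hs.2, neg_abs_le (m : ℝ), le_abs_self (m : ℝ)]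

/-- The coefficient in Córdoba's bound, on the grid of mesh `1 / n`, for the measure of the slopes
in `[m, m + 1)` of lines that meet at least `N` cells of a given set. -/
noncomputable def cordobaConst (m : ℤ) : ℝ := 2 * overlapConst (m.natAbs + 1)

theorem cordobaConst_pos (m : ℤ) : 0 < cordobaConst m :=
  mul_pos two_pos (overlapConst_pos _)

/-- This is Córdoba's `L²` bound for the Kakeya maximal function, in a discrete form. -/
theorem volume_slopes_le (hn : 0 < n) (hS : S ⊆ Ico (m : ℝ) (m + 1)) {P : Set (ℤ × ℤ)}
    (hN : 0 < N) (hSN : ∀ s ∈ S, ENNReal.ofReal N ≤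
      (P ∩ gridCell n '' (slopeLine s (b s) ∩ verticalStrip (Icc (u s) (u s + 1)))).encard) :
    volume S ≤ ENNReal.ofReal (cordobaConst m * (1 + Real.log n) / N ^ 2) * P.encard := by
  classical
  have hnpos : (0 : ℝ) < n := Nat.cast_pos.2 hn
  have hm := cordobaConst_pos m
  rcases P.infinite_or_finite with hP | hP
  · have hcoeff : 0 < ENNReal.ofReal (cordobaConst m * (1 + Real.log n) / N ^ 2) :=
      ENNReal.ofReal_pos.2 (by positivity)
    rw [hP.encard_eq, ENat.toENNReal_top, ENNReal.mul_top hcoeff.ne']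
    exact le_top
  lift P to Finset (ℤ × ℤ) using hP
  obtain ⟨T, hTS, hinj, hvol⟩ := exists_separated_slopes hn hS
  set R : ℝ → Finset (ℤ × ℤ) := fun s => {z ∈ P |
    z ∈ gridCell n '' (slopeLine s (b s) ∩ verticalStrip (Icc (u s) (u s + 1)))}
  have hRN : ∀ s ∈ T, N ≤ (R s).card := fun s hs => by
    have hcells : (P ∩ gridCell n '' (slopeLine s (b s) ∩ verticalStrip (Icc (u s) (u s + 1))) :
        Set (ℤ × ℤ)) = R s := (Finset.coe_filter _ P).symm
    have hsN := hSN s (hTS hs)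
    rwa [hcells, encard_coe_eq_coe_finsetCard, ENat.toENNReal_coe,
      ENNReal.ofReal_le_natCast] at hsN
  have hcount := card_slopes_mul_sq_le hn (fun s hs => abs_le_natAbs_add_one (hS (hTS hs))) hinj
    (fun s hs t ht => natAbs_floor_sub_floor_lt hn (hS (hTS hs)) (hS (hTS ht)))
    (fun s _ => Finset.filter_subset _ P) (fun s _ z hz => (Finset.mem_filter.1 hz).2) hN.le hRN
  rw [encard_coe_eq_coe_finsetCard, ENat.toENNReal_coe, ← ENNReal.ofReal_natCast P.card,
    ← ENNReal.ofReal_mul (by positivity)]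
  refine hvol.trans (ENNReal.ofReal_le_ofReal ?_)
  rw [div_mul_eq_mul_div, div_le_div_iff₀ hnpos (by positivity)]
  exact hcount.trans_eq (by rw [cordobaConst]; ring)

end SlopeCounting

section Hausdorff

variable {X : Type*} [EMetricSpace X] {h : ℝ≥0 → ℝ≥0} {r : ℝ≥0∞} {A : Set X}

open Classical in
/-- The extension by `∞` at `∞` of a gauge function to extended distances. -/
noncomputable def extendedGauge (h : ℝ≥0 → ℝ≥0) (d : ℝ≥0∞) : ℝ≥0∞ :=
  if d = ∞ then ∞ else (h d.toNNReal : ℝ≥0∞)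

theorem extendedGauge_coe (h : ℝ≥0 → ℝ≥0) (d : ℝ≥0) : extendedGauge h d = h d := by
  simp [extendedGauge]

theorem extendedGauge_zero (h0 : h 0 = 0) : extendedGauge h 0 = 0 := by
  simp [extendedGauge, h0]

theorem extendedGauge_mono (hh : Monotone h) : Monotone (extendedGauge h) := by
  intro a b hab
  induction b using ENNReal.recTopCoe with
  | top => simp [extendedGauge]
  | coe b =>
    lift a to ℝ≥0 using ne_top_of_le_ne_top ENNReal.coe_ne_top hab
    rw [extendedGauge_coe, extendedGauge_coe]
    exact_mod_cast hh (by exact_mod_cast hab)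

/-- The outer measure, computed from covers by sets of diameter at most `r`, whose supremum over
`r > 0` is the Hausdorff measure of `h`. -/
noncomputable def hausdorffAtScale (X : Type*) [EMetricSpace X] (h : ℝ≥0 → ℝ≥0) (r : ℝ≥0∞) :
    OuterMeasure X :=
  OuterMeasure.mkMetric'.pre (fun s => extendedGauge h (Metric.ediam s)) r

theorem generalizedHausdorff_eq_iSup (h : ℝ≥0 → ℝ≥0) (A : Set X) :
    generalizedHausdorff X h A = ⨆ r > 0, hausdorffAtScale X h r A := by
  change (⨆ r > 0, hausdorffAtScale X h r) A = _
  simp only [OuterMeasure.iSup_apply]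

theorem exists_inv_nat_lt_hausdorffAtScale (hA : 0 < generalizedHausdorff X h A) :
    ∃ n : ℕ, (n : ℝ≥0∞)⁻¹ < hausdorffAtScale X h (n : ℝ≥0∞)⁻¹ A := by
  simp only [generalizedHausdorff_eq_iSup, lt_iSup_iff] at hA
  obtain ⟨r, hr, hrA⟩ := hA
  obtain ⟨n, hn⟩ := ENNReal.exists_inv_nat_lt (lt_min hr hrA).ne'
  obtain ⟨hnr, hnA⟩ := lt_min_iff.1 hn
  exact ⟨n, hnA.trans_le (OuterMeasure.mkMetric'.mono_pre _ hnr.le _)⟩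

theorem le_hausdorffAtScale (h0 : h 0 = 0) {c : ℝ≥0∞}
    (hc : ∀ U : ℕ → Set X, A ⊆ ⋃ i, U i → (∀ i, Metric.ediam (U i) ≤ r) →
      c ≤ ∑' i, extendedGauge h (Metric.ediam (U i))) :
    c ≤ hausdorffAtScale X h r A := by
  rw [hausdorffAtScale, OuterMeasure.mkMetric'.pre, OuterMeasure.boundedBy_apply]
  refine le_iInf₂ fun U hU => ?_
  by_cases hUr : ∀ i, Metric.ediam (U i) ≤ r
  · refine (hc U hU hUr).trans (ENNReal.tsum_le_tsum fun i => ?_)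
    rcases (U i).eq_empty_or_nonempty with hempty | hne
    · simp [hempty, extendedGauge_zero h0]
    · simp [hne, extend, hUr i]
  · obtain ⟨i, hi⟩ := not_forall.1 hUr
    have hne : (U i).Nonempty := by
      by_contra hempty
      simp [not_nonempty_iff_eq_empty.1 hempty] at hi
    refine le_top.trans (le_trans ?_ (ENNReal.le_tsum i))
    simp [hne, extend, hi]

theorem hausdorffAtScale_le_of_ediam_le (hh : Monotone h) {d : ℝ≥0} (hd : Metric.ediam A ≤ d)
    (hdr : d ≤ r) : hausdorffAtScale X h r A ≤ h d :=
  calc hausdorffAtScale X h r A ≤ extendedGauge h (Metric.ediam A) :=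
        OuterMeasure.mkMetric'.pre_le (hd.trans hdr)
    _ ≤ extendedGauge h d := extendedGauge_mono hh hd
    _ = h d := extendedGauge_coe h d

theorem hausdorffAtScale_eq_zero_of_ediam_eq_zero (hh : Monotone h) (h0 : h 0 = 0)
    (hA : Metric.ediam A = 0) : hausdorffAtScale X h r A = 0 := by
  simpa [h0] using hausdorffAtScale_le_of_ediam_le (r := r) hh (d := 0) (by simp [hA]) (by simp)

/-- The `k`-th dyadic range of diameters; these ranges partition `(0, 1]`. -/
def dyadicShell (k : ℕ) : Set ℝ≥0∞ :=
  Ioc ((2⁻¹ ^ (k + 1) : ℝ≥0) : ℝ≥0∞) ((2⁻¹ ^ k : ℝ≥0) : ℝ≥0∞)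

theorem exists_mem_dyadicShell {d : ℝ≥0∞} (h0 : d ≠ 0) (h1 : d ≤ 1) : ∃ k, d ∈ dyadicShell k := by
  lift d to ℝ≥0 using ne_top_of_le_ne_top ENNReal.one_ne_top h1
  obtain ⟨k, hlo, hhi⟩ := exists_nat_pow_near_of_lt_one (x := d) (y := 2⁻¹)
    (pos_iff_ne_zero.2 (by exact_mod_cast h0)) (by exact_mod_cast h1) (by simp)
    (inv_lt_one_of_one_lt₀ one_lt_two)
  exact ⟨k, ENNReal.coe_lt_coe.2 hlo, ENNReal.coe_le_coe.2 hhi⟩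

theorem pairwise_disjoint_dyadicShell : Pairwise (Function.onFun Disjoint dyadicShell) := by
  refine Antitone.pairwise_disjoint_on_Ioc_succ
    (f := fun k : ℕ => ((2⁻¹ ^ k : ℝ≥0) : ℝ≥0∞)) fun k l hkl => ENNReal.coe_le_coe.2 ?_
  exact pow_le_pow_of_le_one zero_le (inv_le_one_of_one_le₀ one_le_two) hkl

theorem tsum_indicator_dyadicShell_le (hh : Monotone h) (d : ℝ≥0∞) :
    ∑' k, (dyadicShell k).indicator (fun _ => (h (2⁻¹ ^ (k + 1)) : ℝ≥0∞)) d ≤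
      extendedGauge h d := by
  by_cases hd : ∃ k, d ∈ dyadicShell k
  · obtain ⟨k, hk⟩ := hd
    rw [tsum_eq_single k fun l hl => indicator_of_notMem
      (disjoint_right.1 (pairwise_disjoint_dyadicShell hl) hk) _, indicator_of_mem hk,
      ← extendedGauge_coe]
    exact extendedGauge_mono hh hk.1.le
  · push Not at hd
    simp [indicator_of_notMem (hd _)]

end Hausdorff

section DyadicCells

theorem ediam_gridCell_preimage_le {n : ℕ} (hn : 0 < n) (z : ℤ × ℤ) :
    Metric.ediam (gridCell n ⁻¹' {z}) ≤ ((2 / n : ℝ≥0) : ℝ≥0∞) := by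
  have hnpos : (0 : ℝ) < n := Nat.cast_pos.2 hn
  refine Metric.ediam_le fun p hp q hq => ?_
  rw [edist_le_coe, ← NNReal.coe_le_coe, coe_nndist, EuclideanSpace.dist_eq, Fin.sum_univ_two]
  obtain ⟨h0, h1⟩ := abs_mul_sub_lt_one_of_gridCell_eq (hp.trans (Eq.symm hq))
  have hcoord : ∀ i, |n * (p i - q i)| < 1 → dist (p i) (q i) ^ 2 ≤ (1 / n : ℝ) ^ 2 := by
    intro i hi
    rw [abs_mul, Nat.abs_cast] at hi
    gcongr
    rw [Real.dist_eq, le_div_iff₀' hnpos]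
    exact hi.le
  refine Real.sqrt_le_iff.2 ⟨NNReal.coe_nonneg _, ?_⟩
  calc dist (p 0) (q 0) ^ 2 + dist (p 1) (q 1) ^ 2 ≤ (1 / n : ℝ) ^ 2 + (1 / n : ℝ) ^ 2 :=
        add_le_add (hcoord 0 h0) (hcoord 1 h1)
    _ ≤ 4 * (1 / n : ℝ) ^ 2 := by linarith [sq_nonneg (1 / n : ℝ)]
    _ = ((2 / n : ℝ≥0) : ℝ) ^ 2 := by
        push_cast
        ring

theorem encard_gridCell_image_le {n c : ℕ} (hn : 0 < n) {V : Set ℝ²}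
    (hV : Metric.ediam V ≤ ((c / n : ℝ≥0) : ℝ≥0∞)) :
    (gridCell n '' V).encard ≤ ((2 * c + 1) ^ 2 : ℕ) := by
  rcases V.eq_empty_or_nonempty with rfl | ⟨q, hq⟩
  · simp
  have hnpos : (0 : ℝ) < n := Nat.cast_pos.2 hn
  set block : Finset (ℤ × ℤ) := Finset.Icc (⌊n * q 0⌋ - c) (⌊n * q 0⌋ + c) ×ˢ
    Finset.Icc (⌊n * q 1⌋ - c) (⌊n * q 1⌋ + c) with hblock
  have hsub : gridCell n '' V ⊆ block := by
    rintro _ ⟨p, hp, rfl⟩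
    have hdist : ‖p - q‖ ≤ c / n := by
      have := (Metric.edist_le_ediam_of_mem hp hq).trans hV
      rw [edist_le_coe, ← NNReal.coe_le_coe, coe_nndist, dist_eq_norm] at this
      simpa using this
    have hcoord : ∀ i, |n * p i - n * q i| ≤ c := fun i => by
      rw [← mul_sub, abs_mul, Nat.abs_cast, ← le_div_iff₀' hnpos]
      exact (PiLp.norm_apply_le (p - q) i).trans hdist
    exact Finset.mk_mem_product (floor_mem_Icc_of_abs_sub_le (hcoord 0))
      (floor_mem_Icc_of_abs_sub_le (hcoord 1))
  have hcard : block.card = (2 * c + 1) ^ 2 := by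
    rw [hblock, Finset.card_product, Int.card_Icc, Int.card_Icc, sq]
    congr 1 <;> omega
  exact (encard_le_encard hsub).trans_eq (by rw [encard_coe_eq_coe_finsetCard, hcard])

variable {ι : Type*} [Countable ι] {f h : ℝ≥0 → ℝ≥0} {r : ℝ≥0∞} {A : Set ℝ²} {U : ι → Set ℝ²}

/-- The cells of mesh `2 ^ (-(k + 1))` that meet a member of the family `U` whose diameter lies in
the `k`-th dyadic shell. -/
noncomputable def shellCells {ι : Type*} (U : ι → Set ℝ²) (k : ℕ) : Set (ℤ × ℤ) :=
  ⋃ i ∈ {i | Metric.ediam (U i) ∈ dyadicShell k}, gridCell (2 ^ (k + 1)) '' U i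

theorem two_mul_inv_two_pow_succ (k : ℕ) : (2 * 2⁻¹ ^ (k + 1) : ℝ≥0) = 2⁻¹ ^ k := by
  rw [pow_succ']
  exact mul_inv_cancel_left₀ two_ne_zero _

theorem two_div_two_pow_succ (k : ℕ) : (2 / (2 ^ (k + 1) : ℕ) : ℝ≥0) = 2⁻¹ ^ k := by
  rw [← two_mul_inv_two_pow_succ, inv_pow, div_eq_mul_inv, Nat.cast_pow, Nat.cast_two]

theorem hausdorffAtScale_le_tsum_shellCells (hf : Monotone f) (hf0 : f 0 = 0)
    (hA : A ⊆ ⋃ i, U i) (hU : ∀ i, 2 * Metric.ediam (U i) ≤ r) (hU1 : ∀ i, Metric.ediam (U i) ≤ 1) :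
    hausdorffAtScale ℝ² f r A ≤
      ∑' k, ((shellCells U k ∩ gridCell (2 ^ (k + 1)) '' A).encard : ℝ≥0∞) * f (2⁻¹ ^ k) := by
  set μ := hausdorffAtScale ℝ² f r
  set Q : ℕ → Set (ℤ × ℤ) := fun k => shellCells U k ∩ gridCell (2 ^ (k + 1)) '' A
  have hcover : A ⊆ (⋃ i ∈ {i | Metric.ediam (U i) = 0}, U i) ∪
      ⋃ k, ⋃ z : Q k, gridCell (2 ^ (k + 1)) ⁻¹' {z.1} := by
    intro p hp
    obtain ⟨i, hi⟩ := mem_iUnion.1 (hA hp)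
    by_cases hzero : Metric.ediam (U i) = 0
    · exact Or.inl (mem_iUnion₂.2 ⟨i, hzero, hi⟩)
    · obtain ⟨k, hk⟩ := exists_mem_dyadicShell hzero (hU1 i)
      exact Or.inr (mem_iUnion₂.2 ⟨k, ⟨gridCell (2 ^ (k + 1)) p,
        mem_iUnion₂.2 ⟨i, hk, mem_image_of_mem _ hi⟩, mem_image_of_mem _ hp⟩, rfl⟩)
  have hnull : μ (⋃ i ∈ {i | Metric.ediam (U i) = 0}, U i) = 0 :=
    (measure_biUnion_null_iff (to_countable _)).2 fun i hi =>
      hausdorffAtScale_eq_zero_of_ediam_eq_zero hf hf0 hi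
  have hcell : ∀ k, ∀ z : Q k, μ (gridCell (2 ^ (k + 1)) ⁻¹' {z.1}) ≤ f (2⁻¹ ^ k) := by
    rintro k ⟨z, hz, -⟩
    obtain ⟨i, hi, -⟩ := mem_iUnion₂.1 hz
    refine hausdorffAtScale_le_of_ediam_le hf ?_ ?_
    · exact two_div_two_pow_succ k ▸ ediam_gridCell_preimage_le (by positivity) z
    · rw [← two_mul_inv_two_pow_succ, ENNReal.coe_mul]
      exact (mul_le_mul_right hi.1.le _).trans (hU i)
  calc μ A ≤ 0 + ∑' k, ∑' z : Q k, μ (gridCell (2 ^ (k + 1)) ⁻¹' {z.1}) := by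
        refine (measure_mono hcover).trans ((measure_union_le _ _).trans ?_)
        rw [hnull]
        gcongr
        exact (measure_iUnion_le _).trans (ENNReal.tsum_le_tsum fun k => measure_iUnion_le _)
    _ ≤ ∑' k, ∑' _ : Q k, (f (2⁻¹ ^ k) : ℝ≥0∞) := by
        rw [zero_add]
        exact ENNReal.tsum_le_tsum fun k => ENNReal.tsum_le_tsum (hcell k)
    _ = ∑' k, ((Q k).encard : ℝ≥0∞) * f (2⁻¹ ^ k) := by simp_rw [ENNReal.tsum_set_const]

theorem encard_shellCells_le (k : ℕ) : ((shellCells U k).encard : ℝ≥0∞) ≤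
    ∑' i, (dyadicShell k).indicator (fun _ => 25) (Metric.ediam (U i)) := by
  have hind : ∀ i, (dyadicShell k).indicator (fun _ => (25 : ℝ≥0∞)) (Metric.ediam (U i)) =
      {i | Metric.ediam (U i) ∈ dyadicShell k}.indicator (fun _ => 25) i := fun _ => rfl
  simp_rw [hind]
  rw [← Measure.count_apply .of_discrete, shellCells, ← tsum_subtype]
  refine (measure_biUnion_le _ (to_countable _) _).trans (ENNReal.tsum_le_tsum fun i => ?_)
  rw [Measure.count_apply .of_discrete]
  have hi := i.2.2
  rw [← two_div_two_pow_succ] at hi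
  exact_mod_cast ENat.toENNReal_le.2 (encard_gridCell_image_le (c := 2) (by positivity) hi)

theorem tsum_encard_shellCells_le (hh : Monotone h) (U : ι → Set ℝ²) :
    ∑' k, ((shellCells U k).encard : ℝ≥0∞) * h (2⁻¹ ^ (k + 1)) ≤
      25 * ∑' i, extendedGauge h (Metric.ediam (U i)) := by
  have hcomm : ∀ k i, (dyadicShell k).indicator (fun _ => (25 : ℝ≥0∞)) (Metric.ediam (U i)) *
      h (2⁻¹ ^ (k + 1)) = 25 *
        (dyadicShell k).indicator (fun _ => (h (2⁻¹ ^ (k + 1)) : ℝ≥0∞)) (Metric.ediam (U i)) := by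
    intro k i
    by_cases hi : Metric.ediam (U i) ∈ dyadicShell k <;> simp [hi]
  calc ∑' k, ((shellCells U k).encard : ℝ≥0∞) * h (2⁻¹ ^ (k + 1))
      ≤ ∑' k, (∑' i, (dyadicShell k).indicator (fun _ => (25 : ℝ≥0∞)) (Metric.ediam (U i))) *
          h (2⁻¹ ^ (k + 1)) := by
        gcongr
        exact encard_shellCells_le _
    _ = 25 * ∑' i, ∑' k,
          (dyadicShell k).indicator (fun _ => (h (2⁻¹ ^ (k + 1)) : ℝ≥0∞)) (Metric.ediam (U i)) := by
        rw [ENNReal.tsum_comm, ← ENNReal.tsum_mul_left]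
        refine tsum_congr fun k => ?_
        rw [← ENNReal.tsum_mul_right, ← ENNReal.tsum_mul_left]
        exact tsum_congr (hcomm k)
    _ ≤ 25 * ∑' i, extendedGauge h (Metric.ediam (U i)) := by
        gcongr
        exact tsum_indicator_dyadicShell_le hh _

end DyadicCells

section LineContent

variable {f : ℝ≥0 → ℝ≥0} {E A : Set ℝ²} {S : Set ℝ}

theorem IsFurstenbergSet.exists_slopeLine (hE : IsFurstenbergSet f E) (s : ℝ) :
    ∃ b, 0 < generalizedHausdorff ℝ² f (slopeLine s b ∩ E) := by
  set v : ℝ² := !₂[1, s] with hv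
  have hv0 : v ≠ 0 := fun h => by simpa [hv] using congrArg (fun p : ℝ² => p 0) h
  obtain ⟨a, t, -, hpos⟩ := hE ((‖v‖⁻¹ : ℝ) • v) (norm_smul_inv_norm hv0)
  refine ⟨a 1 - s * a 0, hpos.trans_le (measure_mono (inter_subset_inter_left E ?_))⟩
  rw [segment_eq_image']
  rintro _ ⟨θ, -, rfl⟩
  simp only [slopeLine, mem_ofPred_eq, add_sub_cancel_left, PiLp.add_apply, PiLp.smul_apply,
    smul_eq_mul, hv, Matrix.cons_val_zero, Matrix.cons_val_one]
  ring

theorem exists_generalizedHausdorff_inter_verticalStrip_pos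
    (hA : 0 < generalizedHausdorff ℝ² f A) :
    ∃ u : ℝ, 0 < generalizedHausdorff ℝ² f (A ∩ verticalStrip (Icc u (u + 1))) := by
  by_contra! hnull
  have hcover : A ⊆ ⋃ m : ℤ, A ∩ verticalStrip (Icc (m : ℝ) (m + 1)) := fun p hp =>
    mem_iUnion.2 ⟨⌊p 0⌋, hp, Int.floor_le _, (Int.lt_floor_add_one _).le⟩
  exact hA.ne' (measure_mono_null hcover
    (measure_iUnion_null fun m => nonpos_iff_eq_zero.1 (hnull m)))

theorem exists_uniform_slopes (hS : volume S ≠ 0)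
    (hSE : ∀ s ∈ S, ∃ b, 0 < generalizedHausdorff ℝ² f (slopeLine s b ∩ E)) :
    ∃ (m : ℤ) (n : ℕ) (b u : ℝ → ℝ) (T : Set ℝ), 0 < n ∧ volume T ≠ 0 ∧
      T ⊆ Ico (m : ℝ) (m + 1) ∧ ∀ s ∈ T, (n : ℝ≥0∞)⁻¹ < hausdorffAtScale ℝ² f (n : ℝ≥0∞)⁻¹
        (slopeLine s (b s) ∩ verticalStrip (Icc (u s) (u s + 1)) ∩ E) := by
  have hstrip : ∀ s ∈ S, ∃ (b u : ℝ) (n : ℕ), (n : ℝ≥0∞)⁻¹ <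
      hausdorffAtScale ℝ² f (n : ℝ≥0∞)⁻¹ (slopeLine s b ∩ verticalStrip (Icc u (u + 1)) ∩ E) := by
    intro s hs
    obtain ⟨b, hb⟩ := hSE s hs
    obtain ⟨u, hu⟩ := exists_generalizedHausdorff_inter_verticalStrip_pos hb
    rw [inter_right_comm] at hu
    exact ⟨b, u, exists_inv_nat_lt_hausdorffAtScale hu⟩
  choose! b u n hn using hstrip
  have hcover : S ⊆ ⋃ i : ℤ × ℕ, {s ∈ S | ⌊s⌋ = i.1 ∧ n s = i.2} := fun s hs =>
    mem_iUnion.2 ⟨(⌊s⌋, n s), hs, rfl, rfl⟩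
  obtain ⟨⟨m, k⟩, hmk⟩ := exists_measure_pos_of_not_measure_iUnion_null
    fun hnull => hS (measure_mono_null hcover hnull)
  refine ⟨m, k, b, u, _, ?_, hmk.ne', ?_, ?_⟩
  · obtain ⟨s, hs, -, hsk⟩ := nonempty_of_measure_ne_zero hmk.ne'
    rw [pos_iff_ne_zero]
    rintro rfl
    simpa [show n s = 0 from hsk] using hn s hs
  · rintro s ⟨-, hsm, -⟩
    exact Int.floor_eq_iff.1 hsm
  · rintro s ⟨hs, -, hsk⟩
    exact (show n s = k from hsk) ▸ hn s hs

end LineContent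

section Pigeonhole

variable {ι : Type*} [Countable ι] {U : ι → Set ℝ²} {𝔥 h : ℝ≥0 → ℝ≥0} {E A : Set ℝ²} {r η : ℝ≥0∞}
  {κ : ℝ}

theorem exists_lt_encard_shellCells_inter {N : ℕ → ℝ≥0∞} (h𝔥 : Monotone 𝔥) (h𝔥0 : 𝔥 0 = 0)
    (hA : A ⊆ ⋃ i, U i) (hU : ∀ i, 2 * Metric.ediam (U i) ≤ r) (hU1 : ∀ i, Metric.ediam (U i) ≤ 1)
    (hN : ∑' k, N k * 𝔥 (2⁻¹ ^ k) ≤ η) (hη : η < hausdorffAtScale ℝ² 𝔥 r A) :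
    ∃ k, N k < (shellCells U k ∩ gridCell (2 ^ (k + 1)) '' A).encard := by
  by_contra! hle
  refine hη.not_ge ((hausdorffAtScale_le_tsum_shellCells h𝔥 h𝔥0 hA hU hU1).trans (le_trans ?_ hN))
  gcongr
  exact hle _

/-- The number of cells at scale `k`, up to the factor `κ`, for which Córdoba's bound for the
measure of a set of slopes turns into the `h`-weight of the cells. -/
noncomputable def cellThreshold (h : ℝ≥0 → ℝ≥0) (κ : ℝ) (k : ℕ) : ℝ :=
  κ * √((k + 1) / h (2⁻¹ ^ (k + 1)))

theorem exists_tsum_cellThreshold_le {C : ℝ≥0} (hC : ∀ x, 𝔥 (2 * x) ≤ C * 𝔥 x)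
    (hsum : Summable fun k : ℕ =>
      √((k : ℝ) * ((𝔥 ((2 : ℝ≥0)⁻¹ ^ k) : ℝ) ^ 2 / (h ((2 : ℝ≥0)⁻¹ ^ k) : ℝ))))
    {η : ℝ} (hη : 0 < η) :
    ∃ κ > 0, ∑' k, ENNReal.ofReal (cellThreshold h κ k) * 𝔥 (2⁻¹ ^ k) ≤ ENNReal.ofReal η := by
  rw [← summable_nat_add_iff 1] at hsum
  set a : ℕ → ℝ := fun k => √((k + 1 : ℕ) * (𝔥 (2⁻¹ ^ (k + 1)) ^ 2 / h (2⁻¹ ^ (k + 1)))) with ha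
  have ha0 : ∀ k, 0 ≤ a k := fun k => Real.sqrt_nonneg _
  have hden : 0 < C * ∑' k, a k + 1 :=
    add_pos_of_nonneg_of_pos (mul_nonneg C.coe_nonneg (tsum_nonneg ha0)) one_pos
  set κ := η / (C * ∑' k, a k + 1)
  have hκ : 0 < κ := div_pos hη hden
  have hterm : ∀ k, ENNReal.ofReal (cellThreshold h κ k) * 𝔥 (2⁻¹ ^ k) ≤
      ENNReal.ofReal (κ * C * a k) := by
    intro k
    have hdouble : (𝔥 (2⁻¹ ^ k) : ℝ) ≤ C * 𝔥 (2⁻¹ ^ (k + 1)) := by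
      rw [← two_mul_inv_two_pow_succ]
      exact_mod_cast hC _
    have hthreshold : 0 ≤ cellThreshold h κ k := mul_nonneg hκ.le (Real.sqrt_nonneg _)
    rw [← ENNReal.ofReal_coe_nnreal, ← ENNReal.ofReal_mul hthreshold]
    refine ENNReal.ofReal_le_ofReal ((mul_le_mul_of_nonneg_left hdouble hthreshold).trans_eq ?_)
    simp only [ha]
    rw [cellThreshold, Nat.cast_add_one, mul_div_left_comm,
      Real.sqrt_mul (sq_nonneg _), Real.sqrt_sq (NNReal.coe_nonneg _)]
    ring
  refine ⟨κ, hκ, (ENNReal.tsum_le_tsum hterm).trans ?_⟩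
  have hκC : 0 ≤ κ * C := mul_nonneg hκ.le C.coe_nonneg
  rw [← ENNReal.ofReal_tsum_of_nonneg (fun k => mul_nonneg hκC (ha0 k)) (hsum.mul_left _),
    tsum_mul_left]
  refine ENNReal.ofReal_le_ofReal ?_
  calc κ * C * ∑' k, a k ≤ κ * (C * ∑' k, a k + 1) := by linarith
    _ = η := div_mul_cancel₀ η hden.ne'

variable {m : ℤ} {S : Set ℝ} {b u : ℝ → ℝ}

theorem volume_slopes_le_encard_mul {k : ℕ} (hh : 0 < h (2⁻¹ ^ (k + 1))) (hκ : 0 < κ)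
    (hS : S ⊆ Ico (m : ℝ) (m + 1)) {P : Set (ℤ × ℤ)}
    (hP : ∀ s ∈ S, ENNReal.ofReal (cellThreshold h κ k) ≤ (P ∩ gridCell (2 ^ (k + 1)) ''
      (slopeLine s (b s) ∩ verticalStrip (Icc (u s) (u s + 1)))).encard) :
    volume S ≤ ENNReal.ofReal (2 * cordobaConst m / κ ^ 2) * (P.encard * h (2⁻¹ ^ (k + 1))) := by
  have hm := cordobaConst_pos m
  have hN : 0 < cellThreshold h κ k := by
    unfold cellThreshold
    positivity
  have hlog : 1 + Real.log (2 ^ (k + 1) : ℕ) ≤ 2 * (k + 1) := by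
    rw [Nat.cast_pow, Real.log_pow]
    push_cast
    nlinarith [Real.log_two_lt_d9]
  calc volume S
      ≤ ENNReal.ofReal (cordobaConst m * (1 + Real.log (2 ^ (k + 1) : ℕ)) /
          cellThreshold h κ k ^ 2) * P.encard := volume_slopes_le (by positivity) hS hN hP
    _ ≤ ENNReal.ofReal (cordobaConst m * (2 * (k + 1)) / cellThreshold h κ k ^ 2) *
          P.encard := by gcongr
    _ = ENNReal.ofReal (2 * cordobaConst m / κ ^ 2 * h (2⁻¹ ^ (k + 1))) * P.encard := by
        rw [cellThreshold, mul_pow, Real.sq_sqrt (by positivity)]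
        congr 2
        field_simp
    _ = ENNReal.ofReal (2 * cordobaConst m / κ ^ 2) * (P.encard * h (2⁻¹ ^ (k + 1))) := by
        rw [ENNReal.ofReal_mul (by positivity), ENNReal.ofReal_coe_nnreal]
        ring

theorem volume_slopes_le_tsum_extendedGauge (h𝔥 : Monotone 𝔥) (h𝔥0 : 𝔥 0 = 0)
    (hh : Monotone h) (hhpos : ∀ x > 0, 0 < h x) (hκ : 0 < κ)
    (hη : ∑' k, ENNReal.ofReal (cellThreshold h κ k) * 𝔥 (2⁻¹ ^ k) ≤ η)
    (hS : S ⊆ Ico (m : ℝ) (m + 1)) (hSE : ∀ s ∈ S, η < hausdorffAtScale ℝ² 𝔥 r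
      (slopeLine s (b s) ∩ verticalStrip (Icc (u s) (u s + 1)) ∩ E))
    (hE : E ⊆ ⋃ i, U i) (hU : ∀ i, 2 * Metric.ediam (U i) ≤ r)
    (hU1 : ∀ i, Metric.ediam (U i) ≤ 1) :
    volume S ≤ ENNReal.ofReal (2 * cordobaConst m / κ ^ 2) *
      (25 * ∑' i, extendedGauge h (Metric.ediam (U i))) := by
  set good : ℕ → Set ℝ := fun k => {s ∈ S | ENNReal.ofReal (cellThreshold h κ k) ≤
    (shellCells U k ∩ gridCell (2 ^ (k + 1)) ''
      (slopeLine s (b s) ∩ verticalStrip (Icc (u s) (u s + 1)))).encard}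
  have hcover : S ⊆ ⋃ k, good k := by
    intro s hs
    obtain ⟨k, hk⟩ := exists_lt_encard_shellCells_inter h𝔥 h𝔥0 (inter_subset_right.trans hE)
      hU hU1 hη (hSE s hs)
    refine mem_iUnion.2 ⟨k, hs, hk.le.trans (ENat.toENNReal_le.2 (encard_le_encard ?_))⟩
    exact inter_subset_inter_right _ (image_mono inter_subset_left)
  calc volume S ≤ ∑' k, volume (good k) := (measure_mono hcover).trans (measure_iUnion_le _)
    _ ≤ ∑' k, ENNReal.ofReal (2 * cordobaConst m / κ ^ 2) *
          ((shellCells U k).encard * h (2⁻¹ ^ (k + 1))) :=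
        ENNReal.tsum_le_tsum fun k => volume_slopes_le_encard_mul (hhpos _ (by positivity)) hκ
          ((sep_subset _ _).trans hS) fun s hs => hs.2
    _ ≤ _ := by
        rw [ENNReal.tsum_mul_left]
        gcongr
        exact tsum_encard_shellCells_le hh U

end Pigeonhole

theorem DimensionallySmaller.pos {g f : ℝ≥0 → ℝ≥0} (hgf : DimensionallySmaller g f)
    (hg : Monotone g) {x : ℝ≥0} (hx : 0 < x) : 0 < g x := by
  obtain ⟨y, hy, hyx⟩ := (hgf.1.and (Ioo_mem_nhdsGT hx)).exists
  exact hy.trans_le (hg hyx.2.le)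

theorem mainTheorem1_general {𝔥 h : ℝ≥0 → ℝ≥0} {E : Set ℝ²} {S : Set ℝ} {C : ℝ≥0}
    (h𝔥 : Monotone 𝔥) (h𝔥0 : 𝔥 0 = 0) (hC : ∀ x, 𝔥 (2 * x) ≤ C * 𝔥 x) (hS : volume S ≠ 0)
    (hSE : ∀ s ∈ S, ∃ b, 0 < generalizedHausdorff ℝ² 𝔥 (slopeLine s b ∩ E))
    (hh : Monotone h) (hh0 : h 0 = 0) (hhpos : ∀ x > 0, 0 < h x)
    (hsum : Summable fun k : ℕ =>
      √((k : ℝ) * ((𝔥 ((2 : ℝ≥0)⁻¹ ^ k) : ℝ) ^ 2 / (h ((2 : ℝ≥0)⁻¹ ^ k) : ℝ)))) :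
    0 < generalizedHausdorff ℝ² h E := by
  obtain ⟨m, n, b, u, T, hn, hT, hTm, hTE⟩ := exists_uniform_slopes hS hSE
  have hn1 : (1 : ℝ≥0∞) ≤ n := by exact_mod_cast hn
  obtain ⟨κ, hκ, hη⟩ := exists_tsum_cellThreshold_le hC hsum (η := (n : ℝ)⁻¹) (by positivity)
  rw [ENNReal.ofReal_inv_of_pos (by positivity), ENNReal.ofReal_natCast] at hη
  set B : ℝ≥0∞ := ENNReal.ofReal (2 * cordobaConst m / κ ^ 2) * 25
  have hcontent : volume T / B ≤ hausdorffAtScale ℝ² h ((n : ℝ≥0∞)⁻¹ / 2) E := by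
    refine le_hausdorffAtScale hh0 fun U hEU hU => ENNReal.div_le_of_le_mul' ?_
    rw [mul_assoc]
    refine volume_slopes_le_tsum_extendedGauge h𝔥 h𝔥0 hh hhpos hκ hη hTm hTE hEU (fun i => ?_)
      fun i => (hU i).trans (ENNReal.half_le_self.trans (ENNReal.inv_le_one.2 hn1))
    exact mul_comm (2 : ℝ≥0∞) _ ▸ (ENNReal.le_div_iff_mul_le (by simp) (by simp)).1 (hU i)
  have hscale : 0 < (n : ℝ≥0∞)⁻¹ / 2 := ENNReal.div_pos (by simp) (by simp)
  calc 0 < volume T / B := ENNReal.div_pos hT (by finiteness)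
    _ ≤ hausdorffAtScale ℝ² h ((n : ℝ≥0∞)⁻¹ / 2) E := hcontent
    _ ≤ generalizedHausdorff ℝ² h E := by
        rw [generalizedHausdorff_eq_iSup]
        exact le_iSup₂ (f := fun r _ => hausdorffAtScale ℝ² h r E) _ hscale

theorem mainTheorem1 (𝔥 h : ℝ≥0 → ℝ≥0) (E : Set (EuclideanSpace ℝ (Fin 2)))
    (h𝔥 : IsDoublingDimensionFunction 𝔥) (hE : IsFurstenbergSet 𝔥 E)
    (hh : IsDimensionFunction h)
    (hlt : DimensionallySmaller h (fun x => 𝔥 x ^ 2))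
    (hsum : Summable fun k : ℕ =>
      Real.sqrt ((k : ℝ) * ((𝔥 ((2 : ℝ≥0)⁻¹ ^ k) : ℝ) ^ 2 / (h ((2 : ℝ≥0)⁻¹ ^ k) : ℝ)))) :
    0 < generalizedHausdorff (EuclideanSpace ℝ (Fin 2)) h E := by
  obtain ⟨C, -, hC⟩ := h𝔥.doubling
  exact mainTheorem1_general (S := univ) h𝔥.monotone h𝔥.map_zero hC (by simp)
    (fun s _ => hE.exists_slopeLine s) hh.monotone hh.map_zero (fun _ => hlt.pos hh.monotone) hsum
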